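/- Let $\mathcal{RH}_\infty^{n\times n}$ be the set of $n\times n$ matrices of real rational functions that are proper and have no pole in $\{\operatorname{Re} s\ge 0\}$. For a complex $n\times n$ matrix $M$ acting on $\mathbb{C}^n$ with the Euclidean norm and inner product (linear in the second slot), let $$\mathrm{SRG}(M)=\Big\{\tfrac{\|Mu\|}{\|u\|}\,e^{\pm i\arccos\frac{\operatorname{Re}\langle u,Mu\rangle}{\|Mu\|\,\|u\|}} : u\neq 0\Big\}$$ (the point is $0$ if $Mu=0$), and for $\theta\in\mathbb{R}$ let $\mathrm{SRG}_\theta(M)=e^{i\theta}\,\mathrm{SRG}(e^{-i\theta}M)$. Put $\mathbb{D}_r=\{z\in\mathbb{C}:|z|\le r\}$ and $\mathbb{K}_{[a,b]}=\{z\in\mathbb{C}: a\le\angle z\le b\}\cup\{0\}$ (arguments modulo $2\pi$). Let $\gamma>0$ and let $\alpha\le\beta$ be real. Define the following sets of $\Delta\in\mathcal{RH}_\infty^{n\times n}$: - disc uncertainty $\mathcal{G}_\gamma$: $\mathrm{SRG}(\Delta(i\omega))\subseteq\mathbb{D}_\gamma$ for all $\omega\in[0,\infty]$; - conic uncertainty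 $\mathcal{C}_{[\alpha,\beta]}$: $\mathrm{SRG}_{(\alpha+\beta)/2}(\Delta(i\omega))\subseteq\mathbb{K}_{[\alpha,\beta]}$ for all $\omega\in[0,\infty]$; - sectorial uncertainty $\mathcal{S}_{\gamma,[\alpha,\beta]}$: $\mathrm{SRG}_{(\alpha+\beta)/2}(\Delta(i\omega))\subseteq\mathbb{D}_\gamma\cap\mathbb{K}_{[\alpha,\beta]}$ for all $\omega\in[0,\infty]$. Call $G\in\mathcal{RH}_\infty^{n\times n}$ robustly stable with respect to a set $\Xi\subseteq\mathcal{RH}_\infty^{n\times n}$ if $I+G\Delta$ has an inverse in $\mathcal{RH}_\infty^{n\times n}$ for every $\Delta\in\Xi$. **Corollary.** Let $G\in\mathcal{RH}_\infty^{n\times n}$. 1. $G$ is robustly stable with respect to $\mathcal{G}_\gamma$ if $\mathrm{SRG}(G(i\omega))\subseteq\operatorname{int}\mathbb{D}_{1/\gamma}$ for each $\omega\in[0,\infty]$. 2. $G$ is robustly stable with respect to $\mathcal{C}_{[\alpha,\beta]}$ if, for each $\omega\in[0,\infty]$, $\mathrm{SRG}_{-(\alpha+\beta)/2}(G(i\omega))\subseteq\{0\}\cup\operatorname{int}\mathbb{K}_{[-\alpha-\pi,\,\pi-\beta]}$.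 3. $G$ is robustly stable with respect to $\mathcal{S}_{\gamma,[\alpha,\beta]}$ if, for each $\omega\in[0,\infty]$, $\mathrm{SRG}_{-(\alpha+\beta)/2}(G(i\omega))\subseteq\operatorname{int}\big(\mathbb{D}_{1/\gamma}\cup\mathbb{K}_{[-\alpha-\pi,\,\pi-\beta]}\big)$. If $\alpha<\beta$, $\operatorname{int}$ is the topological interior in $\mathbb{C}$. If $\alpha=\beta$, the two edges of the cone $\mathbb{K}_{[-\alpha-\pi,\,\pi-\alpha]}$ coincide and count as boundary: the region in item 2 is then $\mathbb{C}\setminus\{re^{-i(\alpha+\pi)}:r>0\}$, and the region in item 3 is $\mathbb{C}\setminus\{re^{-i(\alpha+\pi)}:r\ge 1/\gamma\}$. -/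

import Mathlib

open scoped ENNReal

noncomputable section

/-! ### Regions in the complex plane -/

/-- The closed disc of radius `γ` centred at the origin. -/
def disc (γ : ℝ) : Set ℂ := {z | ‖z‖ ≤ γ}

/-- The cone `{z : a ≤ ∠ z ≤ b} ∪ {0}`; the argument `∠ z` is taken modulo `2π`, so that `a, b` may
be arbitrary reals. -/
def cone (a b : ℝ) : Set ℂ :=
  {z | ∃ φ : ℝ, a ≤ φ ∧ φ ≤ b ∧ z = (‖z‖ : ℂ) * Complex.exp (φ * Complex.I)} ∪ {0}

/-- The sector: a disc intersected with a cone. -/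
def sector (γ a b : ℝ) : Set ℂ := disc γ ∩ cone a b

/-! ### Scaled relative graphs -/

section SRG

variable {H : Type*} [NormedAddCommGroup H] [InnerProductSpace ℂ H]

/-- The gain of `T` at the input `u`. -/
def inputGain (T : H →L[ℂ] H) (u : H) : ℝ := ‖T u‖ / ‖u‖

/-- The angle of `T` at the input `u`, a number in `[0, π]`. If `T u = 0` its value is irrelevant,
since the gain vanishes there. -/
def inputAngle (T : H →L[ℂ] H) (u : H) : ℝ :=
  Real.arccos ((inner ℂ u (T u)).re / (‖T u‖ * ‖u‖))

/-- The scaled relative graph of `T`. -/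
def SRG (T : H →L[ℂ] H) : Set ℂ :=
  {z | ∃ u : H, u ≠ 0 ∧
    (z = (inputGain T u : ℂ) * Complex.exp (inputAngle T u * Complex.I) ∨
      z = (inputGain T u : ℂ) * Complex.exp (-(inputAngle T u * Complex.I)))}

/-- The `θ`-SRG of `T`, that is `e^{iθ} SRG (e^{-iθ} T)`. -/
def thetaSRG (θ : ℝ) (T : H →L[ℂ] H) : Set ℂ :=
  (fun z => Complex.exp (θ * Complex.I) * z) '' SRG (Complex.exp (-(θ * Complex.I)) • T)

end SRG

/-! ### Real rational stable transfer matrices -/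

/-- A real rational function in the variable `s` is stable if it is proper and has no pole in the
closed right half plane. -/
def IsStableRational (r : RatFunc ℝ) : Prop :=
  r.num.natDegree ≤ r.denom.natDegree ∧ ∀ s : ℂ, 0 ≤ s.re → Polynomial.aeval s r.denom ≠ 0

/-- The set of `n × n` real rational stable transfer matrices. -/
def RHinf (n : ℕ) : Set (Matrix (Fin n) (Fin n) (RatFunc ℝ)) :=
  {G | ∀ i j, IsStableRational (G i j)}

/-- The value `r(iω)` for `ω ∈ [0, ∞]`; at `ω = ∞` it is the limit at infinity of the proper rational
function `r` (recall that `r.denom` is monic). -/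
def freqValue (r : RatFunc ℝ) (ω : ℝ≥0∞) : ℂ :=
  if ω = ∞ then ((r.num.coeff r.denom.natDegree : ℝ) : ℂ)
  else r.eval (algebraMap ℝ ℂ) (Complex.I * (ω.toReal : ℂ))

/-- The frequency response `G(iω)`, as an operator on `ℂⁿ` with its Euclidean norm. -/
def freqResponse {n : ℕ} (G : Matrix (Fin n) (Fin n) (RatFunc ℝ)) (ω : ℝ≥0∞) :
    EuclideanSpace ℂ (Fin n) →L[ℂ] EuclideanSpace ℂ (Fin n) :=
  Matrix.toEuclideanCLM (n := Fin n) (𝕜 := ℂ) (G.map fun r => freqValue r ω)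

/-! ### Uncertainty sets and robust stability -/

/-- Disc uncertainty. -/
def discUncertainty (n : ℕ) (γ : ℝ) : Set (Matrix (Fin n) (Fin n) (RatFunc ℝ)) :=
  {D | D ∈ RHinf n ∧ ∀ ω : ℝ≥0∞, SRG (freqResponse D ω) ⊆ disc γ}

/-- Conic uncertainty. -/
def conicUncertainty (n : ℕ) (α β : ℝ) : Set (Matrix (Fin n) (Fin n) (RatFunc ℝ)) :=
  {D | D ∈ RHinf n ∧ ∀ ω : ℝ≥0∞, thetaSRG ((β + α) / 2) (freqResponse D ω) ⊆ cone α β}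

/-- Sectorial uncertainty. -/
def sectorialUncertainty (n : ℕ) (γ α β : ℝ) : Set (Matrix (Fin n) (Fin n) (RatFunc ℝ)) :=
  {D | D ∈ RHinf n ∧ ∀ ω : ℝ≥0∞, thetaSRG ((β + α) / 2) (freqResponse D ω) ⊆ sector γ α β}

/-- The negative feedback interconnection defined through `G` is robustly stable with respect to `Ξ`:
`I + GΔ` has an inverse among the real rational stable transfer matrices for every `Δ ∈ Ξ`. -/
def RobustlyStable {n : ℕ} (G : Matrix (Fin n) (Fin n) (RatFunc ℝ))
    (Ξ : Set (Matrix (Fin n) (Fin n) (RatFunc ℝ))) : Prop :=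
  ∀ D ∈ Ξ, ∃ K ∈ RHinf n, (1 + G * D) * K = 1 ∧ K * (1 + G * D) = 1

end

/-! ### Roots of a continuous family of real polynomials -/

section Roots

open Polynomial

/-! The return difference is deformed along `I + tGΔ`, `t ∈ [0, 1]`. Suppose it is singular at a
frequency `ω ∈ [0, ∞]` for some `t > 0`, with kernel vector `u`. Then `G(iω)` sends `Δ(iω)u` to
`-u/t`. The two gains multiply to `1/t ≥ 1`, and after opposite rotations the two angles are
supplementary. So the graph of `Δ` contains some `g e^{iψ}` and that of `G` some `ρ e^{i(π-ψ)}` with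
`ρ ≥ 1/g` (`exists_thetaSRG_of_feedback`). Each pair of regions in the theorem excludes this.

Hence `det (I + tGΔ)` vanishes at no frequency, infinity included. A common stable denominator `q`
turns it into a real polynomial family `P t` with `P 0 = q`. Nonvanishing at infinity keeps the
degree constant, nonvanishing at finite frequencies keeps roots off the imaginary axis, so no root
can enter the right half plane (`aeval_ne_zero_of_homotopy`). At `t = 1` the determinant is
therefore a unit of the ring of stable rational functions, and `I + GΔ` is invertible over that ring
(`isUnit_one_add_of_homotopy`). -/

theorem exists_root_norm_sub_lt (p : ℂ[X]) (s : ℂ) {ε : ℝ} (hε : 0 ≤ ε)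
    (h : ‖p.eval s‖ < ‖p.leadingCoeff‖ * ε ^ p.natDegree) : ∃ z, p.eval z = 0 ∧ ‖s - z‖ < ε := by
  by_contra! hc
  refine absurd h (not_lt.2 ?_)
  -- `|p(s)|` is `|leadingCoeff|` times the product of the distances from `s` to the roots; if each
  -- is at least `ε`, the product is at least `ε ^ natDegree`.
  have hs := IsAlgClosed.splits p
  rw [hs.eval_eq_prod_roots, norm_mul, hs.natDegree_eq_card_roots]
  refine mul_le_mul_of_nonneg_left ?_ (norm_nonneg _)
  have key : ∀ m : Multiset ℂ, (∀ z ∈ m, ε ≤ ‖s - z‖) →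
      ε ^ Multiset.card m ≤ ‖(m.map fun z => s - z).prod‖ := by
    intro m
    induction m using Multiset.induction_on with
    | empty => simp
    | cons a m ih =>
      intro hm
      simp only [Multiset.card_cons, Multiset.map_cons, Multiset.prod_cons, pow_succ', norm_mul]
      exact mul_le_mul (hm a (Multiset.mem_cons_self a m))
        (ih fun z hz => hm z (Multiset.mem_cons_of_mem hz)) (pow_nonneg hε _) (norm_nonneg _)
  exact key _ fun z hz => hc z (isRoot_of_mem_roots hz)

/-- Cauchy's bound: outside the unit disc the top term of a root equation is controlled by the
others. It keeps the roots of the homotopy in one compact ball. -/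
theorem norm_root_le (p : ℂ[X]) {N : ℕ} (hN : p.natDegree ≤ N) (h0 : p.coeff N ≠ 0) {s : ℂ}
    (hs : p.eval s = 0) :
    ‖s‖ ≤ max 1 ((∑ i ∈ Finset.range N, ‖p.coeff i‖) / ‖p.coeff N‖) := by
  rcases le_or_gt ‖s‖ 1 with h1 | h1
  · exact le_max_of_le_left h1
  refine le_max_of_le_right ?_
  rw [le_div_iff₀ (norm_pos_iff.2 h0)]
  rw [eval_eq_sum_range' (Nat.lt_succ_of_le hN), Finset.sum_range_succ] at hs
  rcases N with _ | m
  · simp at hs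
    exact absurd hs h0
  have h2 : ‖p.coeff (m + 1)‖ * ‖s‖ ^ (m + 1) ≤
      (∑ i ∈ Finset.range (m + 1), ‖p.coeff i‖) * ‖s‖ ^ m := by
    rw [← norm_pow, ← norm_mul, eq_neg_of_add_eq_zero_right hs, norm_neg, Finset.sum_mul]
    refine (norm_sum_le _ _).trans (Finset.sum_le_sum fun i hi => ?_)
    rw [norm_mul, norm_pow]
    exact mul_le_mul_of_nonneg_left
      (pow_le_pow_right₀ h1.le (Nat.lt_succ_iff.1 (Finset.mem_range.1 hi))) (norm_nonneg _)
  rw [pow_succ', ← mul_assoc] at h2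
  have := le_of_mul_le_mul_right h2 (pow_pos (zero_lt_one.trans h1) m)
  linarith

/-- A continuous family of real polynomials of constant degree without roots on the imaginary axis
keeps its roots in the open left half plane. -/
theorem aeval_ne_zero_of_homotopy (P : unitInterval → ℝ[X]) (N : ℕ)
    (hdeg : ∀ t, (P t).natDegree ≤ N) (hcont : ∀ i, Continuous fun t => (P t).coeff i)
    (hlead : ∀ t, (P t).coeff N ≠ 0)
    (haxis : ∀ t (ω : ℝ), 0 ≤ ω → aeval (Complex.I * ω) (P t) ≠ 0)
    (hzero : ∀ s : ℂ, 0 ≤ s.re → aeval s (P 0) ≠ 0) (t : unitInterval) (s : ℂ) (hs : 0 ≤ s.re) :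
    aeval s (P t) ≠ 0 := by
  -- Real coefficients make the roots conjugation-invariant, so nonnegative frequencies cover the
  -- whole axis.
  have haxis' : ∀ t (s : ℂ), s.re = 0 → aeval s (P t) ≠ 0 := by
    intro t s hs h
    rcases le_total 0 s.im with hi | hi
    · refine haxis t s.im hi ?_
      rwa [show Complex.I * (s.im : ℂ) = s by apply Complex.ext <;> simp [hs]]
    · refine haxis t (-s.im) (by linarith) ?_
      rw [show Complex.I * ((-s.im : ℝ) : ℂ) = (starRingEnd ℂ) s by
        apply Complex.ext <;> simp [hs], aeval_conj, h, map_zero]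
  have heval : ∀ (t : unitInterval) (s : ℂ),
      aeval s (P t) = ∑ i ∈ Finset.range (N + 1), ((P t).coeff i : ℂ) * s ^ i := by
    intro t s
    rw [aeval_eq_sum_range' (Nat.lt_succ_of_le (hdeg t))]
    simp [Algebra.smul_def]
  have hcontE : Continuous fun x : unitInterval × ℂ => aeval x.2 (P x.1) := by
    simp only [heval]
    refine continuous_finsetSum _ fun i _ => ?_
    exact (Complex.continuous_ofReal.comp ((hcont i).comp continuous_fst)).mul
      (continuous_snd.pow i)
  -- `Z` collects the unstable parameters. It is clopen in the connected interval and misses `0`,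
  -- hence is empty.
  set Z : Set unitInterval := {t | ∃ s : ℂ, 0 ≤ s.re ∧ aeval s (P t) = 0} with hZ
  have hclosed : IsClosed Z := by
    have hb : Continuous fun t : unitInterval =>
        max 1 ((∑ i ∈ Finset.range N, ‖(((P t).coeff i : ℝ) : ℂ)‖) / ‖(((P t).coeff N : ℝ) : ℂ)‖) := by
      refine continuous_const.max (Continuous.div ?_ ?_ ?_)
      · exact continuous_finsetSum _ fun i _ =>
          (Complex.continuous_ofReal.comp (hcont i)).norm
      · exact (Complex.continuous_ofReal.comp (hcont N)).norm
      · intro t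
        simpa using hlead t
    obtain ⟨R, hR⟩ := isCompact_univ.bddAbove_image hb.continuousOn
    -- The unstable pairs `(t, s)` form a closed bounded set, whose projection to `t` is compact.
    have hK : IsCompact {x : unitInterval × ℂ | 0 ≤ x.2.re ∧ aeval x.2 (P x.1) = 0} := by
      refine IsCompact.of_isClosed_subset (isCompact_univ.prod (isCompact_closedBall (0 : ℂ) R))
        ?_ ?_
      · exact (isClosed_le continuous_const (Complex.continuous_re.comp continuous_snd)).inter
          (isClosed_eq hcontE continuous_const)
      · rintro ⟨t, s⟩ ⟨-, h⟩
        refine ⟨Set.mem_univ _, ?_⟩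
        rw [mem_closedBall_zero_iff]
        refine le_trans ?_ (hR ⟨t, Set.mem_univ _, rfl⟩)
        have := norm_root_le ((P t).map (algebraMap ℝ ℂ)) (natDegree_map_le.trans (hdeg t))
          (s := s) (by simpa using hlead t) (by rwa [eval_map_algebraMap])
        simpa using this
    convert (hK.image continuous_fst).isClosed using 1
    ext t
    simp [hZ]
  have hopen : IsOpen Z := by
    rw [isOpen_iff_mem_nhds]
    rintro t ⟨s, hs, h⟩
    have hs' : 0 < s.re := lt_of_le_of_ne hs fun h' => haxis' t s h'.symm h
    have hc1 : Continuous fun t => ‖aeval s (P t)‖ :=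
      (hcontE.comp (continuous_id.prodMk continuous_const)).norm
    have hc2 : Continuous fun t => ‖(((P t).coeff N : ℝ) : ℂ)‖ * s.re ^ N :=
      (Complex.continuous_ofReal.comp (hcont N)).norm.mul continuous_const
    have hlt : ‖aeval s (P t)‖ < ‖(((P t).coeff N : ℝ) : ℂ)‖ * s.re ^ N := by
      rw [h, norm_zero]
      exact mul_pos (norm_pos_iff.2 (by simpa using hlead t)) (pow_pos hs' N)
    filter_upwards [hc1.continuousAt.eventually_lt hc2.continuousAt hlt] with t' ht'
    have hd : (P t').natDegree = N := le_antisymm (hdeg t') (le_natDegree_of_ne_zero (hlead t'))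
    -- With radius `s.re`, the nearby root of `P t'` still lies in the right half plane.
    obtain ⟨z, hz, hzs⟩ := exists_root_norm_sub_lt ((P t').map (algebraMap ℝ ℂ)) s hs (by
      rw [eval_map_algebraMap, natDegree_map, leadingCoeff_map, leadingCoeff, hd]
      exact ht')
    rw [eval_map_algebraMap] at hz
    refine ⟨z, ?_, hz⟩
    have := (Complex.re_le_norm (s - z)).trans_lt hzs
    rw [Complex.sub_re] at this
    linarith
  rcases isClopen_iff.1 ⟨hclosed, hopen⟩ with h | h
  · intro h'
    have : t ∈ Z := ⟨s, hs, h'⟩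
    simp [h] at this
  · obtain ⟨z, hz, hz'⟩ : (0 : unitInterval) ∈ Z := h ▸ Set.mem_univ _
    exact absurd hz' (hzero z hz)

end Roots

/-! ### The ring of stable rational functions -/

section Stable

open Polynomial

/-- A real polynomial without zeros in the closed right half plane. -/
def IsStablePoly (q : ℝ[X]) : Prop := ∀ s : ℂ, 0 ≤ s.re → aeval s q ≠ 0

theorem IsStablePoly.ne_zero {q : ℝ[X]} (hq : IsStablePoly q) : q ≠ 0 := by
  rintro rfl
  exact hq 0 le_rfl (map_zero _)

theorem IsStablePoly.mul {p q : ℝ[X]} (hp : IsStablePoly p) (hq : IsStablePoly q) :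
    IsStablePoly (p * q) := fun s hs => by
  rw [map_mul]
  exact mul_ne_zero (hp s hs) (hq s hs)

theorem isStablePoly_one : IsStablePoly 1 := fun s _ => by simp

theorem IsStableRational.denom {r : RatFunc ℝ} (hr : IsStableRational r) : IsStablePoly r.denom :=
  hr.2

theorem algebraMap_ratFunc_ne_zero {q : ℝ[X]} (hq : q ≠ 0) : algebraMap ℝ[X] (RatFunc ℝ) q ≠ 0 :=
  RatFunc.algebraMap_ne_zero hq

theorem num_mul_eq_of_eq_div {r : RatFunc ℝ} {p q : ℝ[X]} (hq : q ≠ 0)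
    (h : r = algebraMap _ _ p / algebraMap _ _ q) : r.num * q = p * r.denom :=
  (RatFunc.num_mul_eq_mul_denom_iff hq).2 h

/-- Lets stability be read off an unreduced fraction: the reduced denominator divides `q`, and
cross-multiplication preserves the degree gap. -/
theorem isStableRational_of_eq_div {r : RatFunc ℝ} {p q : ℝ[X]} (hq : IsStablePoly q)
    (hpq : p.natDegree ≤ q.natDegree) (h : r = algebraMap _ _ p / algebraMap _ _ q) :
    IsStableRational r := by
  have hm := num_mul_eq_of_eq_div hq.ne_zero h
  refine ⟨?_, fun s hs h0 => ?_⟩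
  · rcases eq_or_ne r 0 with rfl | hr
    · simp
    have hp : p ≠ 0 := by
      rintro rfl
      simp at h
      exact hr h
    have := congrArg natDegree hm
    rw [natDegree_mul (RatFunc.num_ne_zero hr) hq.ne_zero,
      natDegree_mul hp (RatFunc.denom_ne_zero r)] at this
    omega
  · have hd : r.denom ∣ q := h ▸ RatFunc.denom_div_dvd p q
    obtain ⟨d, rfl⟩ := hd
    exact hq s hs (by rw [map_mul, h0, zero_mul])

/-- The value of a stable rational function at infinity. -/
noncomputable def valueAtInfty (r : RatFunc ℝ) : ℂ := ((r.num.coeff r.denom.natDegree : ℝ) : ℂ)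

theorem valueAtInfty_of_eq_div {r : RatFunc ℝ} {p q : ℝ[X]} (hr : IsStableRational r) (hq : q ≠ 0)
    (hpq : p.natDegree ≤ q.natDegree) (h : r = algebraMap _ _ p / algebraMap _ _ q) :
    valueAtInfty r = ((p.coeff q.natDegree / q.leadingCoeff : ℝ) : ℂ) := by
  -- Top coefficients in the cross-multiplied identity; `r.denom` is monic.
  have hm := congrArg (fun x => coeff x (r.denom.natDegree + q.natDegree))
    (num_mul_eq_of_eq_div hq h)
  rw [coeff_mul_add_eq_of_natDegree_le hr.1 le_rfl, add_comm, coeff_mul_add_eq_of_natDegree_le hpq le_rfl,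
    (RatFunc.monic_denom r).coeff_natDegree, mul_one] at hm
  rw [valueAtInfty, ← hm, leadingCoeff, mul_div_cancel_right₀ _ (by simpa using hq)]

/-- The value of a rational function at a point of the complex plane. -/
noncomputable def valueAt (s : ℂ) (r : RatFunc ℝ) : ℂ := r.eval (algebraMap ℝ ℂ) s

theorem valueAt_of_eq_div {s : ℂ} {r : RatFunc ℝ} {p q : ℝ[X]} (hr : aeval s r.denom ≠ 0)
    (hq : aeval s q ≠ 0) (h : r = algebraMap _ _ p / algebraMap _ _ q) :
    valueAt s r = aeval s p / aeval s q := by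
  have hq0 : q ≠ 0 := by
    rintro rfl
    simp at hq
  have hm := congrArg (aeval s) (num_mul_eq_of_eq_div hq0 h)
  rw [map_mul, map_mul] at hm
  change aeval s r.num / aeval s r.denom = _
  rw [div_eq_div_iff hr hq, hm]

theorem natDegree_mul_le_mul {p₁ p₂ q₁ q₂ : ℝ[X]} (h₁ : p₁.natDegree ≤ q₁.natDegree)
    (h₂ : p₂.natDegree ≤ q₂.natDegree) (hq₁ : q₁ ≠ 0) (hq₂ : q₂ ≠ 0) :
    (p₁ * p₂).natDegree ≤ (q₁ * q₂).natDegree := by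
  rw [natDegree_mul hq₁ hq₂]
  exact natDegree_mul_le.trans (add_le_add h₁ h₂)

theorem add_eq_div (x y : RatFunc ℝ) :
    x + y = algebraMap _ _ (x.num * y.denom + x.denom * y.num) /
      algebraMap _ _ (x.denom * y.denom) := by
  conv_lhs => rw [← RatFunc.num_div_denom x, ← RatFunc.num_div_denom y,
    div_add_div _ _ (algebraMap_ratFunc_ne_zero (RatFunc.denom_ne_zero x))
      (algebraMap_ratFunc_ne_zero (RatFunc.denom_ne_zero y))]
  simp only [map_add, map_mul]

theorem mul_eq_div (x y : RatFunc ℝ) :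
    x * y = algebraMap _ _ (x.num * y.num) / algebraMap _ _ (x.denom * y.denom) := by
  conv_lhs => rw [← RatFunc.num_div_denom x, ← RatFunc.num_div_denom y, div_mul_div_comm]
  simp only [map_mul]

theorem IsStableRational.natDegree_add_num {x y : RatFunc ℝ} (hx : IsStableRational x)
    (hy : IsStableRational y) :
    (x.num * y.denom + x.denom * y.num).natDegree ≤ (x.denom * y.denom).natDegree :=
  (natDegree_add_le _ _).trans (max_le
    (natDegree_mul_le_mul hx.1 le_rfl (RatFunc.denom_ne_zero x) (RatFunc.denom_ne_zero y))
    (natDegree_mul_le_mul le_rfl hy.1 (RatFunc.denom_ne_zero x) (RatFunc.denom_ne_zero y)))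

theorem IsStableRational.natDegree_mul_num {x y : RatFunc ℝ} (hx : IsStableRational x)
    (hy : IsStableRational y) :
    (x.num * y.num).natDegree ≤ (x.denom * y.denom).natDegree :=
  natDegree_mul_le_mul hx.1 hy.1 (RatFunc.denom_ne_zero x) (RatFunc.denom_ne_zero y)

theorem IsStableRational.add {x y : RatFunc ℝ} (hx : IsStableRational x)
    (hy : IsStableRational y) : IsStableRational (x + y) :=
  isStableRational_of_eq_div (hx.denom.mul hy.denom) (hx.natDegree_add_num hy) (add_eq_div x y)

theorem IsStableRational.mul {x y : RatFunc ℝ} (hx : IsStableRational x)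
    (hy : IsStableRational y) : IsStableRational (x * y) :=
  isStableRational_of_eq_div (hx.denom.mul hy.denom) (hx.natDegree_mul_num hy) (mul_eq_div x y)

theorem isStableRational_C (c : ℝ) : IsStableRational (RatFunc.C c) :=
  ⟨by simp, fun s _ => by simp⟩

/-- The ring of stable rational functions. -/
def stableSubring : Subring (RatFunc ℝ) where
  carrier := {r | IsStableRational r}
  mul_mem' := IsStableRational.mul
  one_mem' := by simpa using isStableRational_C 1
  add_mem' := IsStableRational.add
  zero_mem' := by simpa using isStableRational_C 0
  neg_mem' := fun {r} hr => by
    have := (isStableRational_C (-1)).mul hr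
    simpa using this

/-- Evaluation of stable rational functions at a point of the closed right half plane. -/
noncomputable def stableEval (s : ℂ) (hs : 0 ≤ s.re) : stableSubring →+* ℂ where
  toFun r := valueAt s r
  map_one' := RatFunc.eval_one _ _
  map_zero' := RatFunc.eval_zero _ _
  map_mul' x y := RatFunc.eval_mul _ _ (x.2.2 s hs) (y.2.2 s hs)
  map_add' x y := RatFunc.eval_add _ _ (x.2.2 s hs) (y.2.2 s hs)

/-- Evaluation of stable rational functions at infinity. -/
noncomputable def stableEvalInfty : stableSubring →+* ℂ where
  toFun r := valueAtInfty r
  map_one' := by simp [valueAtInfty]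
  map_zero' := by simp [valueAtInfty]
  map_mul' := by
    rintro ⟨x, hx⟩ ⟨y, hy⟩
    have hm := (RatFunc.monic_denom x).mul (RatFunc.monic_denom y)
    change valueAtInfty (x * y) = _
    rw [valueAtInfty_of_eq_div (hx.mul hy) hm.ne_zero (hx.natDegree_mul_num hy) (mul_eq_div x y),
      hm.leadingCoeff, (RatFunc.monic_denom x).natDegree_mul (RatFunc.monic_denom y),
      coeff_mul_add_eq_of_natDegree_le hx.1 hy.1]
    simp [valueAtInfty]
  map_add' := by
    rintro ⟨x, hx⟩ ⟨y, hy⟩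
    have hm := (RatFunc.monic_denom x).mul (RatFunc.monic_denom y)
    change valueAtInfty (x + y) = _
    rw [valueAtInfty_of_eq_div (hx.add hy) hm.ne_zero (hx.natDegree_add_num hy) (add_eq_div x y),
      hm.leadingCoeff, (RatFunc.monic_denom x).natDegree_mul (RatFunc.monic_denom y), coeff_add,
      coeff_mul_add_eq_of_natDegree_le hx.1 le_rfl, coeff_mul_add_eq_of_natDegree_le le_rfl hy.1,
      (RatFunc.monic_denom x).coeff_natDegree, (RatFunc.monic_denom y).coeff_natDegree]
    simp [valueAtInfty]

/-- Evaluation of stable rational functions at `iω`, `ω ∈ [0, ∞]`. -/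
noncomputable def freqHom (ω : ℝ≥0∞) : stableSubring →+* ℂ :=
  if ω = ∞ then stableEvalInfty else stableEval (Complex.I * (ω.toReal : ℂ)) (by simp)

theorem freqHom_apply (ω : ℝ≥0∞) (r : stableSubring) : freqHom ω r = freqValue r ω := by
  unfold freqHom freqValue
  split_ifs <;> rfl

/-- A stable rational function is a unit if it has no zero in the closed right half plane,
infinity included. -/
theorem isUnit_of_stableEval_ne_zero (r : stableSubring) (h : ∀ s hs, stableEval s hs r ≠ 0)
    (h' : stableEvalInfty r ≠ 0) : IsUnit r := by
  obtain ⟨r, hr⟩ := r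
  have h0 : r ≠ 0 := by
    rintro rfl
    exact h' (map_zero stableEvalInfty)
  -- A nonzero value at infinity is what makes `r⁻¹` proper.
  have hcoeff : r.num.coeff r.denom.natDegree ≠ 0 := by
    intro h0
    exact h' (by change valueAtInfty r = 0; simp [valueAtInfty, h0])
  have hnum : IsStablePoly r.num := by
    intro s hs h0
    refine h s hs ?_
    change aeval s r.num / aeval s r.denom = 0
    rw [h0, zero_div]
  have hinv : IsStableRational r⁻¹ := by
    refine isStableRational_of_eq_div hnum (le_natDegree_of_ne_zero hcoeff) ?_
    conv_lhs => rw [← RatFunc.num_div_denom r, inv_div]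
  exact IsUnit.of_mul_eq_one (⟨r⁻¹, hinv⟩ : stableSubring) (Subtype.ext (mul_inv_cancel₀ h0))

/-- Finitely many stable rational functions have a common stable denominator. -/
theorem exists_common_denom (c : ℕ → stableSubring) (n : ℕ) :
    ∃ q : ℝ[X], IsStablePoly q ∧ ∃ p : ℕ → ℝ[X], ∀ k < n, (p k).natDegree ≤ q.natDegree ∧
      (c k : RatFunc ℝ) = algebraMap _ _ (p k) / algebraMap _ _ q := by
  induction n with
  | zero => exact ⟨1, isStablePoly_one, fun _ => 0, by simp⟩
  | succ n ih =>
    obtain ⟨q, hq, p, hp⟩ := ih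
    have hd := (c n).2.denom
    refine ⟨q * (c n : RatFunc ℝ).denom, hq.mul hd,
      fun k => if k < n then p k * (c n : RatFunc ℝ).denom else q * (c n : RatFunc ℝ).num, ?_⟩
    intro k hk
    have hq0 := algebraMap_ratFunc_ne_zero hq.ne_zero
    have hd0 := algebraMap_ratFunc_ne_zero hd.ne_zero
    rcases Nat.lt_succ_iff_lt_or_eq.1 hk with hk | rfl
    · simp only [if_pos hk]
      refine ⟨natDegree_mul_le_mul (hp k hk).1 le_rfl hq.ne_zero hd.ne_zero, ?_⟩
      rw [(hp k hk).2, map_mul, map_mul, mul_div_mul_right _ _ hd0]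
    · simp only [lt_irrefl, if_false]
      refine ⟨natDegree_mul_le_mul le_rfl (c k).2.1 hq.ne_zero hd.ne_zero, ?_⟩
      rw [map_mul, map_mul, mul_div_mul_left _ _ hq0, RatFunc.num_div_denom]

end Stable

/-! ### Separation of scaled relative graphs -/

section Separation

variable {H : Type*} [NormedAddCommGroup H] [InnerProductSpace ℂ H]

/-- A unimodular factor changes the angle but not the gain. Separation only needs the point with the
positive sign. -/
theorem thetaSRG_mem (θ : ℝ) (T : H →L[ℂ] H) {u : H} (hu : u ≠ 0) :
    (inputGain T u : ℂ) *
      Complex.exp (((θ + inputAngle (Complex.exp (-(θ * Complex.I)) • T) u : ℝ) : ℂ) * Complex.I) ∈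
      thetaSRG θ T := by
  refine ⟨_, ⟨u, hu, Or.inl rfl⟩, ?_⟩
  have h : inputGain (Complex.exp (-(θ * Complex.I)) • T) u = inputGain T u := by
    have : ‖Complex.exp (-(θ * Complex.I))‖ = 1 := by
      rw [← neg_mul, ← Complex.ofReal_neg, Complex.norm_exp_ofReal_mul_I]
    simp [inputGain, norm_smul, this]
  simp only [h]
  rw [Complex.ofReal_add, add_mul, Complex.exp_add]
  ring

/-- If `A` maps `B u` to a negative multiple of `u`, then the angle of the rotated operator `A` at
`B u` is supplementary to the angle of the counter-rotated operator `B` at `u`. -/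
theorem inputAngle_of_feedback (A B : H →L[ℂ] H) {t φ : ℝ} (ht : 0 < t) {u : H}
    (h : u + (t : ℂ) • A (B u) = 0) :
    inputAngle (Complex.exp (-((-φ : ℝ) * Complex.I)) • A) (B u) =
      Real.pi - inputAngle (Complex.exp (-(φ * Complex.I)) • B) u := by
  have hA : A (B u) = -(((t⁻¹ : ℝ) : ℂ) • u) := by
    have h1 := eq_neg_of_add_eq_zero_right h
    have ht' : (t : ℂ) ≠ 0 := by exact_mod_cast ht.ne'
    rw [Complex.ofReal_inv, ← smul_neg, ← h1, inv_smul_smul₀ ht']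
  have hn1 : ‖Complex.exp (φ * Complex.I)‖ = 1 := Complex.norm_exp_ofReal_mul_I φ
  have hn2 : ‖Complex.exp (-(φ * Complex.I))‖ = 1 := by
    rw [← neg_mul, ← Complex.ofReal_neg, Complex.norm_exp_ofReal_mul_I]
  have hc : (starRingEnd ℂ) (Complex.exp (-(φ * Complex.I))) = Complex.exp (φ * Complex.I) := by
    rw [← Complex.exp_conj]
    simp
  unfold inputAngle
  rw [← Real.arccos_neg]
  congr 1
  -- Conjugate symmetry moves the rotation to the other slot with opposite sign.
  have hre : (inner ℂ (B u) (Complex.exp (φ * Complex.I) • u)).re =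
      (inner ℂ u (Complex.exp (-(φ * Complex.I)) • B u)).re := by
    rw [← inner_conj_symm, Complex.conj_re, inner_smul_left, inner_smul_right, ← Complex.exp_conj]
    simp
  have hsm : (Complex.exp (-((-φ : ℝ) * Complex.I)) • A) (B u) =
      -(((t⁻¹ : ℝ) : ℂ) • Complex.exp (φ * Complex.I) • u) := by
    rw [smul_apply, hA, smul_neg, smul_comm]
    simp
  rw [hsm, inner_neg_right, inner_smul_right, Complex.neg_re, Complex.re_ofReal_mul, hre, norm_neg,
    norm_smul, norm_smul, smul_apply, norm_smul, hn1, hn2, Complex.norm_real,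
    Real.norm_of_nonneg (inv_pos.2 ht).le, one_mul, one_mul, neg_div, mul_assoc,
    mul_div_mul_left _ _ (inv_pos.2 ht).ne', mul_comm ‖u‖]

/-- A nonzero kernel vector of `I + tAB` yields matching points of the two scaled relative
graphs. -/
theorem exists_thetaSRG_of_feedback (A B : H →L[ℂ] H) (φ : ℝ) {t : ℝ} (ht : 0 < t) (ht1 : t ≤ 1)
    {u : H} (hu : u ≠ 0) (h : u + (t : ℂ) • A (B u) = 0) :
    ∃ g ρ ψ : ℝ, 0 < g ∧ g⁻¹ ≤ ρ ∧
      (g : ℂ) * Complex.exp (ψ * Complex.I) ∈ thetaSRG φ B ∧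
      (ρ : ℂ) * Complex.exp ((Real.pi - ψ : ℝ) * Complex.I) ∈ thetaSRG (-φ) A := by
  have hB : B u ≠ 0 := by
    intro h0
    rw [h0, map_zero, smul_zero, add_zero] at h
    exact hu h
  have hu' := norm_pos_iff.2 hu
  have hB' := norm_pos_iff.2 hB
  refine ⟨inputGain B u, inputGain A (B u), _, div_pos hB' hu', ?_, thetaSRG_mem φ B hu, ?_⟩
  · have h1 : ‖u‖ = t * ‖A (B u)‖ := by
      conv_lhs => rw [eq_neg_of_add_eq_zero_left h]
      rw [norm_neg, norm_smul, Complex.norm_real,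
        Real.norm_of_nonneg ht.le]
    rw [inputGain, inputGain, inv_div]
    refine div_le_div_of_nonneg_right ?_ hB'.le
    rw [h1]
    exact mul_le_of_le_one_left (norm_nonneg _) ht1
  · have := thetaSRG_mem (-φ) A hB
    rw [inputAngle_of_feedback A B ht h] at this
    convert this using 5
    ring

theorem thetaSRG_zero (T : H →L[ℂ] H) : thetaSRG 0 T = SRG T := by
  simp [thetaSRG]

/-- The direction `π - ψ` lies in the open arc `(π - β, π - α)`, which together with the closed arc
from `-α - π` to `π - β` makes one full turn. -/
theorem mul_exp_notMem_cone {α β ρ ψ : ℝ} (hρ : 0 < ρ) (h1 : α < ψ) (h2 : ψ < β) :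
    (ρ : ℂ) * Complex.exp ((Real.pi - ψ : ℝ) * Complex.I) ∉ cone (-α - Real.pi) (Real.pi - β) := by
  have hρ' : (ρ : ℂ) ≠ 0 := by exact_mod_cast hρ.ne'
  rintro (⟨φ, hφ1, hφ2, h⟩ | h)
  · rw [norm_mul, Complex.norm_exp_ofReal_mul_I, mul_one, Complex.norm_real,
      Real.norm_of_nonneg hρ.le] at h
    obtain ⟨k, hk⟩ := Complex.exp_eq_exp_iff_exists_int.1 (mul_left_cancel₀ hρ' h)
    have hk' : Real.pi - ψ = φ + k * (2 * Real.pi) := by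
      have := congrArg Complex.im hk
      simpa using this
    have hpi := Real.pi_pos
    -- `k ≤ 0` would force `ψ ≥ β`, and `k ≥ 1` would force `ψ ≤ α`.
    rcases lt_or_ge k 1 with hk1 | hk1
    · have : (k : ℝ) ≤ 0 := by exact_mod_cast Int.lt_add_one_iff.1 hk1
      nlinarith
    · have : (1 : ℝ) ≤ k := by exact_mod_cast hk1
      nlinarith
  · simp [hρ.ne'] at h

/-- The point may lie on the boundary, but increasing the modulus and moving the angle into `(α, β)`
gives arbitrarily close points outside the union. This is where `α < β` enters. -/
theorem mul_exp_notMem_interior {α β ρ ψ : ℝ} (hαβ : α < β) (hρ : 0 < ρ) (h1 : α ≤ ψ) (h2 : ψ ≤ β)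
    {r : ℝ} (hr : r ≤ ρ) :
    (ρ : ℂ) * Complex.exp ((Real.pi - ψ : ℝ) * Complex.I) ∉
      interior (disc r ∪ cone (-α - Real.pi) (Real.pi - β)) := by
  intro h
  let F : ℝ × ℝ → ℂ := fun x => (x.1 : ℂ) * Complex.exp ((Real.pi - x.2 : ℝ) * Complex.I)
  have hF : Continuous F := by fun_prop
  have hcl : (ρ, ψ) ∈ closure (Set.Ioi ρ ×ˢ Set.Ioo α β) := by
    rw [closure_prod_eq, closure_Ioi, closure_Ioo hαβ.ne]
    exact ⟨Set.self_mem_Ici, h1, h2⟩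
  obtain ⟨⟨ρ', ψ'⟩, hx, hρ', hψ'⟩ := mem_closure_iff.1 hcl _ (isOpen_interior.preimage hF) h
  simp only [Set.mem_Ioi] at hρ'
  rcases interior_subset hx with hd | hc
  · have hd' : ‖F (ρ', ψ')‖ ≤ r := hd
    rw [norm_mul, Complex.norm_exp_ofReal_mul_I, mul_one, Complex.norm_real,
      Real.norm_of_nonneg (hρ.trans hρ').le] at hd'
    linarith
  · exact mul_exp_notMem_cone (hρ.trans hρ') hψ'.1 hψ'.2 hc

/-- Cone membership fixes `ψ` only modulo `2π`; passing to a representative in `[a, b]` leaves the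
matching point of the other graph unchanged. -/
theorem exists_arg_of_mem_cone {a b g ψ : ℝ} (hg : 0 < g)
    (h : (g : ℂ) * Complex.exp (ψ * Complex.I) ∈ cone a b) :
    ∃ φ : ℝ, a ≤ φ ∧ φ ≤ b ∧
      Complex.exp ((Real.pi - ψ : ℝ) * Complex.I) = Complex.exp ((Real.pi - φ : ℝ) * Complex.I) := by
  have hg' : (g : ℂ) ≠ 0 := by exact_mod_cast hg.ne'
  rcases h with ⟨φ, h1, h2, h⟩ | h
  · rw [norm_mul, Complex.norm_exp_ofReal_mul_I, mul_one, Complex.norm_real,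
      Real.norm_of_nonneg hg.le] at h
    refine ⟨φ, h1, h2, ?_⟩
    simp only [Complex.ofReal_sub, sub_mul, Complex.exp_sub, mul_left_cancel₀ hg' h]
  · simp [hg.ne'] at h

theorem exp_neg_sub_pi (α : ℝ) : Complex.exp ((-α - Real.pi : ℝ) * Complex.I) =
    Complex.exp ((Real.pi - α : ℝ) * Complex.I) := by
  refine Complex.exp_eq_exp_iff_exists_int.2 ⟨-1, ?_⟩
  push_cast
  ring

end Separation

/-! ### The return difference along the homotopy -/

section Stability

open Polynomial

theorem freqHom_top : freqHom ∞ = stableEvalInfty := if_pos rfl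

theorem freqHom_ofReal {ω : ℝ} (hω : 0 ≤ ω) :
    freqHom (ENNReal.ofReal ω) = stableEval (Complex.I * (ω : ℂ)) (by simp) := by
  simp [freqHom, ENNReal.toReal_ofReal hω]

/-- Treats the return difference determinant as one polynomial in `t` with stable coefficients, so
that `t` and the frequency are substituted together. -/
theorem eval₂_det_one_add_X_smul {R : Type*} [CommRing R] {n : ℕ} (f : R →+* ℂ)
    (M : Matrix (Fin n) (Fin n) R) (t : ℂ) :
    eval₂ f t (1 + (X : R[X]) • M.map C).det = (1 + t • f.mapMatrix M).det := by
  rw [← coe_eval₂RingHom, RingHom.map_det]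
  congr 1
  ext i j
  simp [Matrix.one_apply, apply_ite (eval₂ f t)]
  exact mul_comm _ _

/-- If the return difference `I + tM` is nonsingular at all frequencies along the homotopy
`t ∈ [0, 1]`, then `I + M` is invertible over the stable rational functions. -/
theorem isUnit_one_add_of_homotopy {n : ℕ} (M : Matrix (Fin n) (Fin n) stableSubring)
    (h : ∀ (ω : ℝ≥0∞) (t : unitInterval),
      (1 + ((t : ℝ) : ℂ) • (freqHom ω).mapMatrix M).det ≠ 0) : IsUnit (1 + M) := by
  set F : stableSubring[X] := (1 + (X : stableSubring[X]) • M.map C).det with hF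
  obtain ⟨q, hq, p, hp⟩ := exists_common_denom F.coeff (F.natDegree + 1)
  have hlead : (q.leadingCoeff : ℂ) ≠ 0 := by exact_mod_cast leadingCoeff_ne_zero.2 hq.ne_zero
  -- The polynomial in `s` obtained from `q · F(t)`; `p k` is the numerator of the `k`-th
  -- coefficient over `q`.
  let P : unitInterval → ℝ[X] := fun t =>
    ∑ k ∈ Finset.range (F.natDegree + 1), C ((t : ℝ) ^ k) * p k
  have hPs : ∀ (t : unitInterval) (s : ℂ) (hs : 0 ≤ s.re),
      aeval s (P t) = (1 + ((t : ℝ) : ℂ) • (stableEval s hs).mapMatrix M).det * aeval s q := by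
    intro t s hs
    rw [← eval₂_det_one_add_X_smul, ← hF, eval₂_eq_sum_range, Finset.sum_mul, map_sum]
    refine Finset.sum_congr rfl fun k hk => ?_
    have hv : stableEval s hs (F.coeff k) = aeval s (p k) / aeval s q :=
      valueAt_of_eq_div ((F.coeff k).2.2 s hs) (hq s hs) (hp k (Finset.mem_range.1 hk)).2
    rw [hv, map_mul, aeval_C]
    field_simp [hq s hs]
    simp [mul_comm]
  -- The coefficient at `q.natDegree` carries the value at infinity, which gives the constant
  -- degree.
  have hPi : ∀ t : unitInterval, (((P t).coeff q.natDegree : ℝ) : ℂ) =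
      (1 + ((t : ℝ) : ℂ) • stableEvalInfty.mapMatrix M).det * q.leadingCoeff := by
    intro t
    rw [← eval₂_det_one_add_X_smul, ← hF, eval₂_eq_sum_range, Finset.sum_mul, finsetSum_coeff,
      Complex.ofReal_sum]
    refine Finset.sum_congr rfl fun k hk => ?_
    have hk := hp k (Finset.mem_range.1 hk)
    have hv : stableEvalInfty (F.coeff k) = (((p k).coeff q.natDegree / q.leadingCoeff : ℝ) : ℂ) :=
      valueAtInfty_of_eq_div (F.coeff k).2 hq.ne_zero hk.1 hk.2
    rw [hv, coeff_C_mul]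
    push_cast
    field_simp
  have hdeg : ∀ t, (P t).natDegree ≤ q.natDegree := fun t =>
    natDegree_sum_le_of_forall_le _ _ fun k hk =>
      (natDegree_C_mul_le _ _).trans (hp k (Finset.mem_range.1 hk)).1
  have hcont : ∀ i, Continuous fun t => (P t).coeff i := by
    intro i
    simp only [P, finsetSum_coeff, coeff_C_mul]
    fun_prop
  have hroots := aeval_ne_zero_of_homotopy P q.natDegree hdeg hcont
    (fun t ht => by
      have := hPi t
      rw [ht, Complex.ofReal_zero, eq_comm, ← freqHom_top] at this
      exact mul_ne_zero (h ∞ t) hlead this)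
    (fun t ω hω => by
      rw [hPs t _ (by simp), ← freqHom_ofReal hω]
      exact mul_ne_zero (h _ t) (hq _ (by simp)))
    (fun s hs => by
      rw [hPs 0 s hs]
      simpa using hq s hs)
  rw [Matrix.isUnit_iff_isUnit_det]
  have hdet : ∀ f : stableSubring →+* ℂ, f (1 + M).det =
      (1 + (((1 : unitInterval) : ℝ) : ℂ) • f.mapMatrix M).det := by
    intro f
    rw [RingHom.map_det, map_add, map_one, Set.Icc.coe_one, Complex.ofReal_one, one_smul]
  refine isUnit_of_stableEval_ne_zero _ (fun s hs h0 => ?_) ?_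
  · refine hroots 1 s hs ?_
    rw [hPs 1 s hs, ← hdet, h0, zero_mul]
  · rw [hdet, ← freqHom_top]
    exact h ∞ 1

theorem det_one_add_smul_mul_ne_zero {n : ℕ} (A B : Matrix (Fin n) (Fin n) ℂ) (t : ℂ)
    (h : ∀ u : EuclideanSpace ℂ (Fin n),
      u + t • Matrix.toEuclideanCLM (n := Fin n) (𝕜 := ℂ) A
        (Matrix.toEuclideanCLM (n := Fin n) (𝕜 := ℂ) B u) = 0 → u = 0) :
    (1 + t • (A * B)).det ≠ 0 := by
  intro h0
  obtain ⟨v, hv, hv0⟩ := Matrix.exists_mulVec_eq_zero_iff.2 h0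
  refine hv ?_
  have := h (WithLp.toLp 2 v) (by
    rw [Matrix.toEuclideanCLM_toLp, Matrix.toEuclideanCLM_toLp, ← WithLp.toLp_smul,
      ← WithLp.toLp_add, Matrix.mulVec_mulVec]
    rw [Matrix.add_mulVec, Matrix.one_mulVec, Matrix.smul_mulVec] at hv0
    rw [hv0, WithLp.toLp_zero])
  simpa using this

/-- Robust stability follows if no nonzero signal closes the loop at any frequency along the
homotopy. -/
theorem robustlyStable_of_feedback {n : ℕ} {G : Matrix (Fin n) (Fin n) (RatFunc ℝ)}
    (hG : G ∈ RHinf n) {Ξ : Set (Matrix (Fin n) (Fin n) (RatFunc ℝ))} (hΞ : Ξ ⊆ RHinf n)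
    (h : ∀ D ∈ Ξ, ∀ (ω : ℝ≥0∞) (t : ℝ), 0 < t → t ≤ 1 → ∀ u,
      u + (t : ℂ) • freqResponse G ω (freqResponse D ω u) = 0 → u = 0) :
    RobustlyStable G Ξ := by
  intro D hD
  let G' : Matrix (Fin n) (Fin n) stableSubring := fun i j => ⟨G i j, hG i j⟩
  let D' : Matrix (Fin n) (Fin n) stableSubring := fun i j => ⟨D i j, hΞ hD i j⟩
  have hresp : ∀ (T : Matrix (Fin n) (Fin n) stableSubring) (ω : ℝ≥0∞),
      freqResponse (stableSubring.subtype.mapMatrix T) ω =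
        Matrix.toEuclideanCLM (n := Fin n) (𝕜 := ℂ) ((freqHom ω).mapMatrix T) := by
    intro T ω
    unfold freqResponse
    congr 1
    ext i j
    simp [freqHom_apply]
  obtain ⟨⟨U, K, hUK, hKU⟩, hU⟩ := isUnit_one_add_of_homotopy (G' * D') (fun ω t => by
    rw [map_mul]
    refine det_one_add_smul_mul_ne_zero _ _ _ fun u hu => ?_
    rcases eq_or_lt_of_le t.2.1 with ht | ht
    · rw [← ht] at hu
      simpa using hu
    · rw [← hresp, ← hresp] at hu
      exact h D hD ω t ht t.2.2 u hu)
  obtain rfl : U = 1 + G' * D' := hU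
  have hval : stableSubring.subtype.mapMatrix (1 + G' * D') = 1 + G * D := by
    rw [map_add, map_mul, map_one]
    rfl
  refine ⟨stableSubring.subtype.mapMatrix K, fun i j => (K i j).2, ?_, ?_⟩
  · rw [← hval, ← map_mul, hUK, map_one]
  · rw [← hval, ← map_mul, hKU, map_one]

/-- Robust stability from separation of the scaled relative graphs: `W` is the region allowed for
the uncertainty and `V` the region allowed for `G`. -/
theorem robustlyStable_of_thetaSRG {n : ℕ} {G : Matrix (Fin n) (Fin n) (RatFunc ℝ)}
    (hG : G ∈ RHinf n) {Ξ : Set (Matrix (Fin n) (Fin n) (RatFunc ℝ))} (hΞ : Ξ ⊆ RHinf n)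
    (φ : ℝ) (V W : Set ℂ)
    (hD : ∀ D ∈ Ξ, ∀ ω : ℝ≥0∞, thetaSRG φ (freqResponse D ω) ⊆ W)
    (hV : ∀ ω : ℝ≥0∞, thetaSRG (-φ) (freqResponse G ω) ⊆ V)
    (hsep : ∀ g ρ ψ : ℝ, 0 < g → g⁻¹ ≤ ρ → (g : ℂ) * Complex.exp (ψ * Complex.I) ∈ W →
      (ρ : ℂ) * Complex.exp ((Real.pi - ψ : ℝ) * Complex.I) ∉ V) :
    RobustlyStable G Ξ := by
  refine robustlyStable_of_feedback hG hΞ fun D hDΞ ω t ht ht1 u hu => ?_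
  by_contra hu0
  obtain ⟨g, ρ, ψ, hg, hρ, hB, hA⟩ :=
    exists_thetaSRG_of_feedback (freqResponse G ω) (freqResponse D ω) φ ht ht1 hu0 hu
  exact hsep g ρ ψ hg hρ (hD D hDΞ ω hB) (hV ω hA)

theorem inv_le_of_mul_exp_mem_disc {γ g ρ ψ : ℝ} (hg : 0 < g) (hρ : g⁻¹ ≤ ρ)
    (h : (g : ℂ) * Complex.exp (ψ * Complex.I) ∈ disc γ) : 1 / γ ≤ ρ := by
  have h' : ‖(g : ℂ) * Complex.exp (ψ * Complex.I)‖ ≤ γ := h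
  rw [norm_mul, Complex.norm_exp_ofReal_mul_I, mul_one, Complex.norm_real,
    Real.norm_of_nonneg hg.le] at h'
  rw [one_div]
  exact (inv_anti₀ hg h').trans hρ

theorem interior_disc {r : ℝ} (hr : 0 < r) : interior (disc r) = Metric.ball 0 r := by
  rw [← interior_closedBall (0 : ℂ) hr.ne']
  congr 1
  ext z
  simp [disc]

end Stability

theorem mainTheorem10 (n : ℕ) (γ α β : ℝ) (hγ : 0 < γ) (hαβ : α ≤ β)
    (G : Matrix (Fin n) (Fin n) (RatFunc ℝ)) (hG : G ∈ RHinf n) :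
    -- disc uncertainty
    ((∀ ω : ℝ≥0∞, SRG (freqResponse G ω) ⊆ interior (disc (1 / γ))) →
      RobustlyStable G (discUncertainty n γ)) ∧
    -- conic uncertainty
    (α < β →
      (∀ ω : ℝ≥0∞, thetaSRG (-(α + β) / 2) (freqResponse G ω) ⊆
        {0} ∪ interior (cone (-α - Real.pi) (Real.pi - β))) →
      RobustlyStable G (conicUncertainty n α β)) ∧
    -- conic uncertainty, `α = β`: the cone is the plane cut along the open ray of direction `-α - π`
    (α = β →
      (∀ ω : ℝ≥0∞, thetaSRG (-(α + β) / 2) (freqResponse G ω) ⊆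
        {z | ¬ ∃ r : ℝ, 0 < r ∧ z = (r : ℂ) * Complex.exp ((-α - Real.pi : ℝ) * Complex.I)}) →
      RobustlyStable G (conicUncertainty n α β)) ∧
    -- sectorial uncertainty
    (α < β →
      (∀ ω : ℝ≥0∞, thetaSRG (-(α + β) / 2) (freqResponse G ω) ⊆
        interior (disc (1 / γ) ∪ cone (-α - Real.pi) (Real.pi - β))) →
      RobustlyStable G (sectorialUncertainty n γ α β)) ∧
    -- sectorial uncertainty, `α = β`: the cut starts at distance `1 / γ` from the origin
    (α = β →
      (∀ ω : ℝ≥0∞, thetaSRG (-(α + β) / 2) (freqResponse G ω) ⊆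
        {z | ¬ ∃ r : ℝ, 1 / γ ≤ r ∧ z = (r : ℂ) * Complex.exp ((-α - Real.pi : ℝ) * Complex.I)}) →
      RobustlyStable G (sectorialUncertainty n γ α β)) := by
  have hφ : -(α + β) / 2 = -((β + α) / 2) := by ring
  have hpos : ∀ {g ρ : ℝ}, 0 < g → g⁻¹ ≤ ρ → 0 < ρ := fun hg h => (inv_pos.2 hg).trans_le h
  rw [hφ]
  refine ⟨fun h => ?_, fun hlt h => ?_, fun heq h => ?_, fun hlt h => ?_, fun heq h => ?_⟩
  · refine robustlyStable_of_thetaSRG hG (fun D hD => hD.1) 0 (interior (disc (1 / γ))) (disc γ)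
      (fun D hD ω => by rw [thetaSRG_zero]; exact hD.2 ω)
      (fun ω => by rw [neg_zero, thetaSRG_zero]; exact h ω) ?_
    intro g ρ ψ hg hρ hW hV
    rw [interior_disc (one_div_pos.2 hγ), mem_ball_zero_iff, norm_mul,
      Complex.norm_exp_ofReal_mul_I, mul_one, Complex.norm_real,
      Real.norm_of_nonneg (hpos hg hρ).le] at hV
    exact hV.not_ge (inv_le_of_mul_exp_mem_disc hg hρ hW)
  · refine robustlyStable_of_thetaSRG hG (fun D hD => hD.1) _ _ _ (fun D hD ω => hD.2 ω) h ?_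
    intro g ρ ψ hg hρ hW hV
    obtain ⟨φ, h1, h2, he⟩ := exists_arg_of_mem_cone hg hW
    rw [he] at hV
    have hρ0 := hpos hg hρ
    rcases hV with hV | hV
    · simp [hρ0.ne'] at hV
    -- Used with radius `0`: adjoining the degenerate disc only enlarges the interior.
    · exact mul_exp_notMem_interior hlt hρ0 h1 h2 hρ0.le
        (interior_mono Set.subset_union_right hV)
  · refine robustlyStable_of_thetaSRG hG (fun D hD => hD.1) _ _ _ (fun D hD ω => hD.2 ω) h ?_
    intro g ρ ψ hg hρ hW hV
    obtain ⟨φ, h1, h2, he⟩ := exists_arg_of_mem_cone hg hW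
    -- The degenerate cone is one ray, so the point for `G` falls exactly on the cut.
    obtain rfl : φ = α := by linarith
    exact hV ⟨ρ, hpos hg hρ, by rw [he, exp_neg_sub_pi]⟩
  · refine robustlyStable_of_thetaSRG hG (fun D hD => hD.1) _ _ _ (fun D hD ω => hD.2 ω) h ?_
    intro g ρ ψ hg hρ hW hV
    obtain ⟨φ, h1, h2, he⟩ := exists_arg_of_mem_cone hg hW.2
    rw [he] at hV
    exact mul_exp_notMem_interior hlt (hpos hg hρ) h1 h2 (inv_le_of_mul_exp_mem_disc hg hρ hW.1) hV
  · refine robustlyStable_of_thetaSRG hG (fun D hD => hD.1) _ _ _ (fun D hD ω => hD.2 ω) h ?_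
    intro g ρ ψ hg hρ hW hV
    obtain ⟨φ, h1, h2, he⟩ := exists_arg_of_mem_cone hg hW.2
    obtain rfl : φ = α := by linarith
    exact hV ⟨ρ, inv_le_of_mul_exp_mem_disc hg hρ hW.1, by rw [he, exp_neg_sub_pi]⟩
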